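/- Let $\mathbb Q$ be the real quaternions, $\mathbb D=\{a+b\epsilon: a,b\in\mathbb R\}$ the dual numbers and $\mathbb{DQ}=\{p+q\epsilon : p,q\in\mathbb Q\}$ the dual quaternions, where $\epsilon^2=0$ and $\epsilon$ commutes with everything. Conjugation is $(p+q\epsilon)^*=p^*+q^*\epsilon$, $M^*$ denotes the conjugate transpose of a matrix $M$, and a square matrix $U$ over $\mathbb{DQ}$ is unitary if $U^*U=I$. Dual numbers are totally ordered by $a+b\epsilon\le c+d\epsilon$ iff $a<c$, or $a=c$ and $b\le d$; a dual number $a+b\epsilon$ is appreciable if $a\neq 0$. The singular values of $B\in\mathbb{DQ}^{m\times n}$ are dual numbers $\mu_1\ge\mu_2\ge\dots\ge\mu_{\min\{m,n\}}\ge 0$ such that, for some unitary $V\in\mathbb{DQ}^{m\times m}$ and $U\in\mathbb{DQ}^{n\times n}$, $V^*BU$ is the $m\times n$ matrix with $\mu_1,\dots,\mu_{\min\{m,n\}}$ on its main diagonal and zeros elsewhere. The appreciable rank of $B$ is the number, counted with multiplicity, of its appreciable singular values. **Proposition.** Let $B=B_{st}+B_{\mathcal I}\epsilon\in\mathbb{DQ}^{m\times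 n}$ with $B_{st},B_{\mathcal I}\in\mathbb Q^{m\times n}$. Then $B$ has such singular values, its appreciable rank is well defined (it does not depend on the decomposition used), and it equals the rank of the quaternion matrix $B_{st}$, i.e. the maximal number of right linearly independent columns of $B_{st}$. -/

import Mathlib

open scoped Matrix Quaternion

/-- Dual quaternions `q = q_st + q_I ε`, with `q_st`, `q_I` real quaternions and `ε ^ 2 = 0`, where
`ε` commutes with everything. The standard part is `q.fst`, the infinitesimal part is `q.snd`. -/
abbrev DualQuaternion : Type := DualNumber ℍ[ℝ]

namespace DualQuaternion

/-- The conjugation `(q_st + q_I ε)^* = q_st^* + q_I^* ε`. -/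
noncomputable instance instStarRing : StarRing DualQuaternion where
  star q := TrivSqZeroExt.inl (star q.fst) + TrivSqZeroExt.inr (star q.snd)
  star_involutive q := by ext <;> simp
  star_mul p q := by
    apply TrivSqZeroExt.ext
    · simp
    · simp [add_comm]
  star_add p q := by
    apply TrivSqZeroExt.ext
    · simp
    · simp

theorem fst_star (q : DualQuaternion) : (star q).fst = star q.fst := by
  change (TrivSqZeroExt.inl (star q.fst) + TrivSqZeroExt.inr (star q.snd) : DualQuaternion).fst = _
  simp

theorem snd_star (q : DualQuaternion) : (star q).snd = star q.snd := by
  change (TrivSqZeroExt.inl (star q.fst) + TrivSqZeroExt.inr (star q.snd) : DualQuaternion).snd = _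
  simp

/-- The inclusion of the (real) dual numbers into the dual quaternions. -/
noncomputable def ofDual (d : DualNumber ℝ) : DualQuaternion :=
  TrivSqZeroExt.inl (d.fst : ℍ[ℝ]) + TrivSqZeroExt.inr (d.snd : ℍ[ℝ])

/-- The total order on the dual numbers: compare the standard parts first, and the infinitesimal
parts if the standard parts agree. -/
def DualLE (p q : DualNumber ℝ) : Prop :=
  p.fst < q.fst ∨ (p.fst = q.fst ∧ p.snd ≤ q.snd)

/-- A dual number is appreciable if its standard part is nonzero. -/
def Appreciable (d : DualNumber ℝ) : Prop := d.fst ≠ 0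

/-- The standard part `B_st` of a dual quaternion matrix `B = B_st + B_I ε`. -/
noncomputable def stdPart {m n : ℕ} (B : Matrix (Fin m) (Fin n) DualQuaternion) :
    Matrix (Fin m) (Fin n) ℍ[ℝ] :=
  B.map TrivSqZeroExt.fst

/-- A square dual quaternion matrix `U` is unitary if `U^* U = I`. -/
def IsUnitaryMatrix {n : ℕ} (U : Matrix (Fin n) (Fin n) DualQuaternion) : Prop :=
  Uᴴ * U = 1

/-- The `m × n` dual quaternion matrix with the dual numbers `μ 0, μ 1, …` on its main diagonal and
zeros elsewhere. -/
noncomputable def rectDiagonal {m n : ℕ} (μ : Fin (min m n) → DualNumber ℝ) :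
    Matrix (Fin m) (Fin n) DualQuaternion :=
  Matrix.of fun i j =>
    if h : (i : ℕ) = (j : ℕ) then ofDual (μ ⟨i, lt_min i.isLt (h ▸ j.isLt)⟩) else 0

/-- `μ` is the list of singular values of `B`, in non-increasing order and with the zeros at the
end: nonnegative dual numbers such that `V^* B U` is the rectangular diagonal matrix of `μ`
for some unitary `V` and `U`. In the total order, nonnegative appreciable dual numbers
precede the positive infinitesimal ones, and these precede `0`. -/
def IsSingularValues {m n : ℕ} (B : Matrix (Fin m) (Fin n) DualQuaternion)
    (μ : Fin (min m n) → DualNumber ℝ) : Prop :=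
  (∀ i, DualLE 0 (μ i)) ∧
  (∀ i j, i ≤ j → DualLE (μ j) (μ i)) ∧
  ∃ (V : Matrix (Fin m) (Fin m) DualQuaternion) (U : Matrix (Fin n) (Fin n) DualQuaternion),
    IsUnitaryMatrix V ∧ IsUnitaryMatrix U ∧ Vᴴ * B * U = rectDiagonal μ

/-- `r` is the appreciable rank of `B`: the number, with multiplicity, of appreciable singular
values of `B`. -/
def IsAppreciableRank {m n : ℕ} (B : Matrix (Fin m) (Fin n) DualQuaternion) (r : ℕ) : Prop :=
  ∃ μ : Fin (min m n) → DualNumber ℝ, IsSingularValues B μ ∧ {i | Appreciable (μ i)}.ncard = r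

/-- The rank of a quaternion matrix: the dimension of the right `ℍ`-span of its columns, that is,
the maximal number of right linearly independent columns. -/
noncomputable def quaternionRank {m n : ℕ} (A : Matrix (Fin m) (Fin n) ℍ[ℝ]) : ℕ :=
  Module.finrank (ℍ[ℝ])ᵐᵒᵖ (Submodule.span (ℍ[ℝ])ᵐᵒᵖ (Set.range A.col))

end DualQuaternion

/-! Existence rests on a singular triple: unit vectors `u`, `v` with `B u = v d` and `B^* v = u d`.
If `B_st ≠ 0`, write `B^* B = T + S ε` and view `T`, `S` as symmetric operators on a real Euclidean
space. A nonzero eigenvalue of `T` lifts to first order to an appreciable dual eigenvalue `l` of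
`B^* B` (`exists_unit_eigenvector`). Its standard part is positive, so `l = d ^ 2` with `d`
invertible, and `v = B u d⁻¹`. If `B_st = 0`, a triple of `B_I` is multiplied by `ε`. Completing `u`
and `v` to unitary matrices (`exists_unitary_col_zero`) splits off `d` as a diagonal block.
Induction diagonalizes `B`, and a permutation sorts the diagonal.

For the rank, taking standard parts respects products and conjugate transposes. Every decomposition
of `B` thus yields one of `B_st` with unitary quaternion factors, which preserve the rank; the rank
of the diagonal matrix counts its nonzero entries. -/

/-! ### Eigenvalues of real symmetric operators -/

/-- First order perturbation of an eigenvector: if `a` is an eigenvalue of the symmetric operator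
`T`, then `T + ε S` has an eigenvector `x + ε y` of norm one with eigenvalue `a + ε b`. -/
theorem LinearMap.IsSymmetric.exists_firstOrder_eigenvector {E : Type*} [NormedAddCommGroup E]
    [InnerProductSpace ℝ E] [FiniteDimensional ℝ E] {T S : E →ₗ[ℝ] E} (hT : T.IsSymmetric)
    (hS : S.IsSymmetric) {a : ℝ} (ha : Module.End.HasEigenvalue T a) :
    ∃ (x y : E) (b : ℝ), inner ℝ x x = (1 : ℝ) ∧ inner ℝ x y = (0 : ℝ) ∧ T x = a • x ∧
      T y + S x = a • y + b • x := by
  set K := Module.End.eigenspace T a with hK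
  have : Nontrivial K := Submodule.nontrivial_iff_ne_bot.mpr ha
  -- Degenerate perturbation theory: `x` has to be an eigenvector of the compression `C` of `S` to
  -- the eigenspace `K`. Then `b x - S x` is orthogonal to `K = ker (T - a)`, hence lies in the
  -- range of the symmetric operator `T - a`.
  let C : K →ₗ[ℝ] K := K.orthogonalProjectionOnto.toLinearMap ∘ₗ S ∘ₗ K.subtype
  have hC : C.IsSymmetric := by
    intro x y
    have h1 := K.inner_orthogonalProjectionOnto_eq_of_mem_right y (S x)
    have h2 := K.inner_orthogonalProjectionOnto_eq_of_mem_left x (S y)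
    have h3 := hS x y
    simp only [C, LinearMap.comp_apply, Submodule.subtype_apply, ContinuousLinearMap.coe_coe]
    simp only [Submodule.coe_inner] at *
    rw [h1, h2, h3]
  obtain ⟨b, z, hz⟩ : ∃ (b : ℝ) (z : K), Module.End.HasEigenvector C b z :=
    ⟨_, hC.hasEigenvalue_iSup_of_finiteDimensional.exists_hasEigenvector⟩
  have hz0 : ‖z‖ ≠ 0 := norm_ne_zero_iff.mpr hz.2
  set w : K := ‖z‖⁻¹ • z with hw
  have hCw : C w = b • w := by
    rw [hw, map_smul, hz.apply_eq_smul, smul_comm]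
  have hwn : inner ℝ (w : E) (w : E) = (1 : ℝ) := by
    rw [← Submodule.coe_inner, real_inner_self_eq_norm_sq, hw, norm_smul, norm_inv, norm_norm,
      inv_mul_cancel₀ hz0, one_pow]
  have hTw : T w = a • (w : E) := Module.End.mem_eigenspace_iff.mp w.2
  have hsub : (T - a • LinearMap.id).IsSymmetric := by
    intro x y
    simp [inner_sub_left, inner_sub_right, hT x y, inner_smul_left, inner_smul_right]
  have hmem : b • (w : E) - S w ∈ (T - a • LinearMap.id).range := by
    rw [← Submodule.orthogonal_orthogonal (LinearMap.range (T - a • (LinearMap.id : E →ₗ[ℝ] E))),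
      hsub.orthogonal_range, Submodule.mem_orthogonal]
    intro k hk
    have hkK : k ∈ K := by
      rw [hK, Module.End.mem_eigenspace_iff]
      simpa [sub_eq_zero] using hk
    have h1 := K.inner_orthogonalProjectionOnto_eq_of_mem_left ⟨k, hkK⟩ (S w)
    have h2 : K.orthogonalProjectionOnto (S w) = b • w := hCw
    rw [h2] at h1
    simp only [inner_smul_right, Submodule.coe_inner] at h1
    simp only [inner_sub_right, inner_smul_right]
    rw [← h1]
    simp
  obtain ⟨y, hy⟩ := hmem
  -- Removing the component along `w`, which `T - a` kills, gives orthogonality without affecting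
  -- the equation.
  refine ⟨w, y - inner ℝ (w : E) y • (w : E), b, hwn, ?_, hTw, ?_⟩
  · rw [inner_sub_right, inner_smul_right, hwn, mul_one, sub_self]
  · have hy' : T y = a • y + b • (w : E) - S w := by
      have : T y - a • y = b • (w : E) - S w := by simpa using hy
      rw [sub_eq_iff_eq_add'.mp this]
      abel
    rw [map_sub, map_smul, hTw, hy', smul_sub, smul_comm a]
    abel

theorem LinearMap.IsSymmetric.exists_hasEigenvalue_ne_zero {E : Type*} [NormedAddCommGroup E]
    [InnerProductSpace ℝ E] [FiniteDimensional ℝ E] {T : E →ₗ[ℝ] E} (hT : T.IsSymmetric)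
    (h0 : T ≠ 0) : ∃ a : ℝ, a ≠ 0 ∧ Module.End.HasEigenvalue T a := by
  by_contra! h
  refine h0 ((hT.eigenvectorBasis rfl).toBasis.ext fun i => ?_)
  have h1 : hT.eigenvalues rfl i = 0 := by
    by_contra h2
    exact h _ h2 (hT.hasEigenvalue_eigenvalues rfl i)
  simp [hT.apply_eigenvectorBasis rfl i, h1]

namespace DualQuaternion

/-! ### Dual numbers as central self-adjoint dual quaternions -/

@[simp] theorem fst_ofDual (d : DualNumber ℝ) : (ofDual d).fst = (d.fst : ℍ[ℝ]) := by
  simp [ofDual]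

@[simp] theorem snd_ofDual (d : DualNumber ℝ) : (ofDual d).snd = (d.snd : ℍ[ℝ]) := by
  simp [ofDual]

theorem ofDual_zero : ofDual 0 = 0 := by
  apply TrivSqZeroExt.ext <;> simp

theorem ofDual_one : ofDual 1 = 1 := by
  apply TrivSqZeroExt.ext <;> simp

theorem ofDual_add (c d : DualNumber ℝ) : ofDual (c + d) = ofDual c + ofDual d := by
  apply TrivSqZeroExt.ext <;> simp

theorem ofDual_mul (c d : DualNumber ℝ) : ofDual (c * d) = ofDual c * ofDual d := by
  apply TrivSqZeroExt.ext
  · simp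
  · simp

theorem star_ofDual (d : DualNumber ℝ) : star (ofDual d) = ofDual d := by
  apply TrivSqZeroExt.ext
  · simp [fst_star]
  · simp [snd_star]

theorem ofDual_commute (d : DualNumber ℝ) (q : DualQuaternion) : ofDual d * q = q * ofDual d := by
  apply TrivSqZeroExt.ext
  · simp [Quaternion.coe_commutes]
  · simp [Quaternion.coe_commutes, add_comm]

theorem eq_ofDual_of_star_eq {q : DualQuaternion} (h : star q = q) :
    q = ofDual (TrivSqZeroExt.inl q.fst.re + TrivSqZeroExt.inr q.snd.re) := by
  apply TrivSqZeroExt.ext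
  · simpa [fst_star, Quaternion.star_eq_self] using congrArg TrivSqZeroExt.fst h
  · simpa [snd_star, Quaternion.star_eq_self] using congrArg TrivSqZeroExt.snd h

theorem star_dotProduct_self {n : ℕ} (u : Fin n → DualQuaternion) :
    star (star u ⬝ᵥ u) = star u ⬝ᵥ u := by
  simp [dotProduct]

/-! ### Eigenvectors of Hermitian dual quaternion matrices -/

/-- The real linear map on the Euclidean space of quaternion vectors given by a quaternion
matrix. -/
noncomputable def realOp {n : ℕ} (A : Matrix (Fin n) (Fin n) ℍ[ℝ]) :
    PiLp 2 (fun _ : Fin n => ℍ[ℝ]) →ₗ[ℝ] PiLp 2 (fun _ : Fin n => ℍ[ℝ]) where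
  toFun x := WithLp.toLp 2 (A *ᵥ x.ofLp)
  map_add' x y := by simp [Matrix.mulVec_add]
  map_smul' c x := by simp [Matrix.mulVec_smul]

theorem realOp_apply {n : ℕ} (A : Matrix (Fin n) (Fin n) ℍ[ℝ])
    (x : PiLp 2 (fun _ : Fin n => ℍ[ℝ])) (i : Fin n) : realOp A x i = ∑ j, A i j * x j := rfl

theorem inner_eq_re_dotProduct {n : ℕ} (x y : PiLp 2 (fun _ : Fin n => ℍ[ℝ])) :
    inner ℝ x y = (star x.ofLp ⬝ᵥ y.ofLp).re := by
  have hre : ∀ f : Fin n → ℍ[ℝ], (∑ i, f i).re = ∑ i, (f i).re := fun f =>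
    map_sum (AddMonoidHom.mk' (fun q : ℍ[ℝ] => q.re) (fun _ _ => rfl)) f _
  simp [PiLp.inner_apply, dotProduct, hre, Quaternion.inner_def]

theorem isSymmetric_realOp {n : ℕ} {A : Matrix (Fin n) (Fin n) ℍ[ℝ]} (hA : Aᴴ = A) :
    (realOp A).IsSymmetric := by
  intro x y
  simp only [inner_eq_re_dotProduct]
  change (star (A *ᵥ x.ofLp) ⬝ᵥ y.ofLp).re = (star x.ofLp ⬝ᵥ (A *ᵥ y.ofLp)).re
  rw [Matrix.star_mulVec, hA, Matrix.dotProduct_mulVec]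

theorem realOp_ne_zero {n : ℕ} {A : Matrix (Fin n) (Fin n) ℍ[ℝ]} (hA : A ≠ 0) :
    realOp A ≠ 0 := by
  intro h
  refine hA (Matrix.ext fun i j => ?_)
  have h1 := congrArg (fun z => z i) (LinearMap.congr_fun h (WithLp.toLp 2 (Pi.single j 1)))
  simpa [realOp_apply, Pi.single_apply] using h1

theorem exists_unit_eigenvector {n : ℕ} {M : Matrix (Fin n) (Fin n) DualQuaternion}
    (hM : Mᴴ = M) (h0 : stdPart M ≠ 0) :
    ∃ (u : Fin n → DualQuaternion) (d : DualNumber ℝ), d.fst ≠ 0 ∧ star u ⬝ᵥ u = 1 ∧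
      M *ᵥ u = MulOpposite.op (ofDual d) • u := by
  have hT : (stdPart M)ᴴ = stdPart M := by
    ext1 i j
    have := congrArg TrivSqZeroExt.fst (congrFun₂ hM i j)
    simpa [stdPart, fst_star] using this
  have hS : (M.map TrivSqZeroExt.snd)ᴴ = M.map TrivSqZeroExt.snd := by
    ext1 i j
    have := congrArg TrivSqZeroExt.snd (congrFun₂ hM i j)
    simpa [snd_star] using this
  obtain ⟨a, ha0, ha⟩ :=
    (isSymmetric_realOp hT).exists_hasEigenvalue_ne_zero (realOp_ne_zero h0)
  obtain ⟨x, y, b, hxx, hxy, hTx, hTy⟩ :=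
    (isSymmetric_realOp hT).exists_firstOrder_eigenvector (isSymmetric_realOp hS) ha
  refine ⟨fun i => TrivSqZeroExt.inl (x i) + TrivSqZeroExt.inr (y i),
    TrivSqZeroExt.inl a + TrivSqZeroExt.inr b, by simpa using ha0, ?_, ?_⟩
  -- Since `u^* u` is self-adjoint, it is determined by real parts, so orthogonality for the real
  -- inner product suffices.
  · rw [eq_ofDual_of_star_eq (star_dotProduct_self _), ← ofDual_one]
    have hyx : inner ℝ y x = (0 : ℝ) := by rw [real_inner_comm, hxy]
    rw [inner_eq_re_dotProduct] at hxx hxy hyx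
    congr 1
    apply TrivSqZeroExt.ext
    · simpa [dotProduct, TrivSqZeroExt.fst_sum, fst_star] using hxx
    · simp only [dotProduct, Pi.star_apply] at hxy hyx
      simp [dotProduct, TrivSqZeroExt.snd_sum, fst_star, snd_star, Finset.sum_add_distrib, hxy,
        hyx]
  · ext1 i
    apply TrivSqZeroExt.ext
    · have := congrArg (fun z => z i) hTx
      simp only [realOp_apply] at this
      simpa [Matrix.mulVec, dotProduct, TrivSqZeroExt.fst_sum, stdPart,
        ← Quaternion.coe_commutes, Quaternion.coe_mul_eq_smul] using this
    · have := congrArg (fun z => z i) hTy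
      simp only [PiLp.add_apply, realOp_apply] at this
      simpa [Matrix.mulVec, dotProduct, TrivSqZeroExt.snd_sum, stdPart, Finset.sum_add_distrib,
        ← Quaternion.coe_commutes, Quaternion.coe_mul_eq_smul, add_comm] using this

/-! ### Singular triples -/

/-- `u`, `v` are unit vectors with `B u = v d` and `B^* v = u d`. -/
def IsSingularTriple {m n : ℕ} (B : Matrix (Fin m) (Fin n) DualQuaternion)
    (u : Fin n → DualQuaternion) (v : Fin m → DualQuaternion) (d : DualNumber ℝ) : Prop :=
  star u ⬝ᵥ u = 1 ∧ star v ⬝ᵥ v = 1 ∧ B *ᵥ u = MulOpposite.op (ofDual d) • v ∧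
    Bᴴ *ᵥ v = MulOpposite.op (ofDual d) • u

theorem op_ofDual_smul_smul {n : ℕ} (c d : DualNumber ℝ) (u : Fin n → DualQuaternion) :
    MulOpposite.op (ofDual c) • MulOpposite.op (ofDual d) • u =
      MulOpposite.op (ofDual (d * c)) • u := by
  rw [smul_smul, ← MulOpposite.op_mul, ← ofDual_mul]

theorem dotProduct_op_ofDual_smul {n : ℕ} (d : DualNumber ℝ) (u w : Fin n → DualQuaternion) :
    u ⬝ᵥ (MulOpposite.op (ofDual d) • w) = u ⬝ᵥ w * ofDual d := by
  simp [dotProduct, Finset.sum_mul, mul_assoc]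

theorem star_op_ofDual_smul_dotProduct {n : ℕ} (d : DualNumber ℝ) (u w : Fin n → DualQuaternion) :
    star (MulOpposite.op (ofDual d) • u) ⬝ᵥ w = ofDual d * (star u ⬝ᵥ w) := by
  simp [dotProduct, Finset.mul_sum, mul_assoc, star_ofDual]

theorem re_fst_star_dotProduct_self {n : ℕ} (w : Fin n → DualQuaternion) :
    (star w ⬝ᵥ w).fst.re = ∑ i, Quaternion.normSq (w i).fst := by
  have hre : ∀ f : Fin n → ℍ[ℝ], (∑ i, f i).re = ∑ i, (f i).re := fun f =>
    map_sum (AddMonoidHom.mk' (fun q : ℍ[ℝ] => q.re) (fun _ _ => rfl)) f _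
  simp only [dotProduct, TrivSqZeroExt.fst_sum, hre]
  refine Finset.sum_congr rfl fun i _ => ?_
  rw [Pi.star_apply, TrivSqZeroExt.fst_mul, fst_star, Quaternion.star_mul_self,
    Quaternion.re_coe]

theorem stdPart_mul {l m n : ℕ} (A : Matrix (Fin l) (Fin m) DualQuaternion)
    (B : Matrix (Fin m) (Fin n) DualQuaternion) : stdPart (A * B) = stdPart A * stdPart B := by
  ext1 i j
  simp [stdPart, Matrix.mul_apply, TrivSqZeroExt.fst_sum]

theorem stdPart_conjTranspose {m n : ℕ} (A : Matrix (Fin m) (Fin n) DualQuaternion) :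
    stdPart Aᴴ = (stdPart A)ᴴ := by
  ext1 i j
  simp [stdPart, fst_star]

theorem stdPart_one {n : ℕ} : stdPart (1 : Matrix (Fin n) (Fin n) DualQuaternion) = 1 := by
  ext1 i j
  simp only [stdPart, Matrix.map_apply, Matrix.one_apply]
  split_ifs <;> simp

/-- The diagonal entries of `B_st^* B_st` are the squared norms of the columns of `B_st`. -/
theorem stdPart_conjTranspose_mul_self_ne_zero {m n : ℕ}
    {B : Matrix (Fin m) (Fin n) DualQuaternion} (h : stdPart B ≠ 0) :
    stdPart (Bᴴ * B) ≠ 0 := by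
  contrapose! h
  ext1 i j
  have h1 : (star (B.col j) ⬝ᵥ B.col j).fst.re = 0 := by
    have := congrArg (fun q : ℍ[ℝ] => q.re) (congrFun₂ h j j)
    exact this
  rw [re_fst_star_dotProduct_self,
    Finset.sum_eq_zero_iff_of_nonneg fun _ _ => Quaternion.normSq_nonneg] at h1
  exact Quaternion.normSq_eq_zero.mp (h1 i (Finset.mem_univ i))

theorem exists_singularTriple_of_stdPart_ne_zero {m n : ℕ}
    {B : Matrix (Fin m) (Fin n) DualQuaternion} (h : stdPart B ≠ 0) :
    ∃ u v d, 0 < d.fst ∧ IsSingularTriple B u v d := by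
  obtain ⟨u, l, hl, hu, hMu⟩ := exists_unit_eigenvector
    (Matrix.isHermitian_conjTranspose_mul_self B) (stdPart_conjTranspose_mul_self_ne_zero h)
  have hww : star (B *ᵥ u) ⬝ᵥ (B *ᵥ u) = ofDual l := by
    rw [Matrix.star_mulVec, Matrix.dotProduct_mulVec, Matrix.vecMul_vecMul,
      ← Matrix.dotProduct_mulVec, hMu, dotProduct_op_ofDual_smul, hu, one_mul]
  have hl0 : 0 < l.fst := by
    refine lt_of_le_of_ne ?_ hl.symm
    have h1 := re_fst_star_dotProduct_self (B *ᵥ u)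
    rw [hww, fst_ofDual, Quaternion.re_coe] at h1
    rw [h1]
    exact Finset.sum_nonneg fun _ _ => Quaternion.normSq_nonneg
  obtain ⟨d, hd0, hd⟩ : ∃ d : DualNumber ℝ, 0 < d.fst ∧ d * d = l := by
    have hs := Real.sqrt_pos.mpr hl0
    -- First-order Taylor expansion of the square root at `l.fst > 0`.
    refine ⟨TrivSqZeroExt.inl √l.fst + TrivSqZeroExt.inr (l.snd / (2 * √l.fst)), by simpa using hs,
      ?_⟩
    apply TrivSqZeroExt.ext
    · simp [Real.mul_self_sqrt hl0.le]
    · simp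
      field_simp
      ring
  have hde : d * d⁻¹ = 1 := TrivSqZeroExt.mul_inv_cancel hd0.ne'
  refine ⟨u, MulOpposite.op (ofDual d⁻¹) • (B *ᵥ u), d, hd0, hu, ?_, ?_, ?_⟩
  · rw [star_op_ofDual_smul_dotProduct, dotProduct_op_ofDual_smul, hww, ← ofDual_mul,
      ← ofDual_mul, ← ofDual_one, ← hd]
    congr 1
    linear_combination (d * d⁻¹ + 1) * hde
  · rw [op_ofDual_smul_smul, mul_comm, hde, ofDual_one, MulOpposite.op_one, one_smul]
  · rw [Matrix.mulVec_smul, Matrix.mulVec_mulVec, hMu, op_ofDual_smul_smul]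
    congr 3
    rw [← hd, mul_assoc, hde, mul_one]

theorem exists_singularTriple {m n : ℕ} (B : Matrix (Fin (m + 1)) (Fin (n + 1)) DualQuaternion) :
    ∃ u v d, DualLE 0 d ∧ IsSingularTriple B u v d := by
  by_cases h : stdPart B = 0
  swap
  · obtain ⟨u, v, d, hd, hB⟩ := exists_singularTriple_of_stdPart_ne_zero h
    exact ⟨u, v, d, Or.inl hd, hB⟩
  have hB0 : ∀ i j, (B i j).fst = 0 := fun i j => congrFun₂ h i j
  by_cases h' : B.map TrivSqZeroExt.snd = 0
  · have hB : B = 0 := by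
      ext1 i j
      exact TrivSqZeroExt.ext (hB0 i j) (congrFun₂ h' i j)
    refine ⟨Pi.single 0 1, Pi.single 0 1, 0, Or.inr ⟨rfl, le_rfl⟩, ?_, ?_, ?_, ?_⟩
    · simp
    · simp
    · rw [hB, ofDual_zero, MulOpposite.op_zero, zero_smul, Matrix.zero_mulVec]
    · rw [hB, ofDual_zero, MulOpposite.op_zero, zero_smul]
      simp only [Matrix.conjTranspose_zero, Matrix.zero_mulVec]
  · set C : Matrix (Fin (m + 1)) (Fin (n + 1)) DualQuaternion :=
      Matrix.of fun i j => TrivSqZeroExt.inl (B i j).snd with hC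
    have hC0 : stdPart C ≠ 0 := h'
    obtain ⟨u, v, d, hd, hu, hv, hBu, hBv⟩ := exists_singularTriple_of_stdPart_ne_zero hC0
    -- As `B = C ε`, only the standard parts of the triple of `C` matter, and the singular value
    -- becomes `d.fst ε`.
    refine ⟨fun i => TrivSqZeroExt.inl (u i).fst, fun i => TrivSqZeroExt.inl (v i).fst,
      TrivSqZeroExt.inr d.fst, Or.inr ⟨rfl, hd.le⟩, ?_, ?_, ?_, ?_⟩
    · have := congrArg TrivSqZeroExt.fst hu
      apply TrivSqZeroExt.ext
      · simpa [dotProduct, TrivSqZeroExt.fst_sum, fst_star] using this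
      · simp [dotProduct, TrivSqZeroExt.snd_sum, snd_star]
    · have := congrArg TrivSqZeroExt.fst hv
      apply TrivSqZeroExt.ext
      · simpa [dotProduct, TrivSqZeroExt.fst_sum, fst_star] using this
      · simp [dotProduct, TrivSqZeroExt.snd_sum, snd_star]
    · ext1 i
      have := congrArg TrivSqZeroExt.fst (congrFun hBu i)
      apply TrivSqZeroExt.ext
      · simp [Matrix.mulVec, dotProduct, TrivSqZeroExt.fst_sum, hB0]
      · simpa [Matrix.mulVec, dotProduct, TrivSqZeroExt.fst_sum, TrivSqZeroExt.snd_sum, hC]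
          using this
    · ext1 i
      have := congrArg TrivSqZeroExt.fst (congrFun hBv i)
      apply TrivSqZeroExt.ext
      · simp [Matrix.mulVec, dotProduct, TrivSqZeroExt.fst_sum, hB0, fst_star]
      · simpa [Matrix.mulVec, dotProduct, TrivSqZeroExt.fst_sum, TrivSqZeroExt.snd_sum, hC,
          fst_star, snd_star] using this

/-! ### Completing a unit vector to a unitary matrix -/

/-- Polar decomposition of a dual quaternion. -/
theorem exists_polar (z : DualQuaternion) :
    ∃ (α : DualQuaternion) (d : DualNumber ℝ), star α * α = 1 ∧ 0 ≤ d.fst ∧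
      star z * α = ofDual d := by
  obtain ⟨u, v, d, hd, hu, hv, -, hz⟩ :=
    exists_singularTriple (m := 0) (n := 0) (Matrix.of fun _ _ => z)
  have hu' : star (u 0) * u 0 = 1 := by simpa [dotProduct] using hu
  have hv' : star (v 0) * v 0 = 1 := by simpa [dotProduct] using hv
  have hz' : star z * v 0 = u 0 * ofDual d := by
    simpa [Matrix.mulVec, dotProduct] using congrFun hz 0
  -- Left and right inverses agree here because `u u^*` is a dual number, hence central.
  have huu : u 0 * star (u 0) = 1 := by
    have h1 := eq_ofDual_of_star_eq (q := u 0 * star (u 0)) (by simp)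
    calc u 0 * star (u 0) = u 0 * star (u 0) * (star (u 0) * u 0) := by rw [hu', mul_one]
      _ = star (u 0) * (u 0 * star (u 0)) * u 0 := by rw [← mul_assoc, h1, ofDual_commute]
      _ = (star (u 0) * u 0) * (star (u 0) * u 0) := by noncomm_ring
      _ = 1 := by rw [hu', mul_one]
  refine ⟨v 0 * star (u 0), d, ?_, ?_, ?_⟩
  · rw [star_mul, star_star, mul_assoc, ← mul_assoc (star (v 0)), hv', one_mul, huu]
  · rcases hd with h | h
    · exact h.le
    · exact h.1.le
  · rw [← mul_assoc, hz', ← ofDual_commute, mul_assoc, huu, mul_one]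

/-- Every unit vector is the first column of a unitary matrix. -/
theorem exists_unitary_col_zero {n : ℕ} {u : Fin (n + 1) → DualQuaternion}
    (hu : star u ⬝ᵥ u = 1) :
    ∃ U : Matrix (Fin (n + 1)) (Fin (n + 1)) DualQuaternion, IsUnitaryMatrix U ∧
      U.col 0 = u := by
  obtain ⟨α, d, hα, hd, hz⟩ := exists_polar (u 0)
  have hz' : star α * u 0 = ofDual d := by rw [← star_ofDual, ← hz, star_mul, star_star]
  have hd1 : (1 + d).fst ≠ 0 := by
    simp only [TrivSqZeroExt.fst_add, TrivSqZeroExt.fst_one]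
    positivity
  set c : DualNumber ℝ := (1 + d)⁻¹
  have hc : (1 + d) * c = 1 := TrivSqZeroExt.mul_inv_cancel hd1
  -- Householder reflection: `P = w c w^*` has `P ^ 2 = 2 P`, so `P - 1` is unitary, and it sends
  -- `e₀ α` to `w - e₀ α = u`. The phase `α` makes `α^* u₀ = d` dual with `d.fst ≥ 0`, so `w^* w = 2
  -- (1 + d)` is invertible for every `u`.
  set w : Fin (n + 1) → DualQuaternion := u + Pi.single 0 α with hw
  have hww : star w ⬝ᵥ w = ofDual (1 + d) + ofDual (1 + d) := by
    have hs : star (Pi.single 0 α : Fin (n + 1) → DualQuaternion) = Pi.single 0 (star α) := by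
      rw [Pi.single_star]
    rw [hw, star_add, add_dotProduct, dotProduct_add, dotProduct_add, hu, hs,
      dotProduct_single, single_dotProduct, single_dotProduct, Pi.single_eq_same, hα, hz',
      Pi.star_apply, hz, ofDual_add, ofDual_one]
    abel
  set P : Matrix (Fin (n + 1)) (Fin (n + 1)) DualQuaternion :=
    Matrix.of fun i j => w i * ofDual c * star (w j) with hP
  have hPstar : Pᴴ = P := by
    ext1 i j
    simp [hP, star_ofDual, mul_assoc]
  have hPP : P * P = P + P := by
    ext1 i j
    have h1 : (P * P) i j = w i * ofDual c * (star w ⬝ᵥ w) * ofDual c * star (w j) := by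
      simp only [hP, Matrix.mul_apply, Matrix.of_apply, dotProduct, Finset.mul_sum,
        Finset.sum_mul, Pi.star_apply, mul_assoc]
    have h2 : (ofDual (1 + d) + ofDual (1 + d)) * ofDual c = 1 + 1 := by
      rw [add_mul, ← ofDual_mul, hc, ofDual_one]
    rw [h1, hww, mul_assoc (w i * _), h2]
    simp only [hP, Matrix.add_apply, Matrix.of_apply]
    noncomm_ring
  have hH : (P - 1)ᴴ * (P - 1) = 1 := by
    rw [Matrix.conjTranspose_sub, hPstar, Matrix.conjTranspose_one, sub_mul, mul_sub, hPP]
    noncomm_ring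
  set D : Matrix (Fin (n + 1)) (Fin (n + 1)) DualQuaternion :=
    Matrix.diagonal (Function.update 1 0 α) with hD
  have hDD : Dᴴ * D = 1 := by
    rw [hD, Matrix.diagonal_conjTranspose, Matrix.diagonal_mul_diagonal, Matrix.diagonal_eq_one]
    ext1 i
    by_cases hi : i = 0
    · subst hi
      simp [hα]
    · simp [hi]
  refine ⟨(P - 1) * D, ?_, ?_⟩
  · rw [IsUnitaryMatrix, Matrix.conjTranspose_mul, mul_assoc, ← mul_assoc _ (P - 1), hH, one_mul,
      hDD]
  · ext1 i
    have hw0 : star (w 0) * α = ofDual (1 + d) := by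
      rw [hw, Pi.add_apply, Pi.single_eq_same, star_add, add_mul, hz, hα, ofDual_add, ofDual_one,
        add_comm]
    have h1 : P i 0 * α = w i := by
      simp only [hP, Matrix.of_apply]
      rw [mul_assoc, hw0, mul_assoc, ← ofDual_mul, mul_comm c, hc, ofDual_one, mul_one]
    rw [Matrix.col_apply, hD, Matrix.mul_diagonal, Function.update_self, Matrix.sub_apply, sub_mul,
      h1, hw]
    by_cases hi : i = 0
    · subst hi
      simp
    · simp [hi]

/-! ### Diagonalization by induction -/

/-- The block diagonal matrix with blocks `a` and `M`. -/
noncomputable def border {m n : ℕ} (a : DualQuaternion) (M : Matrix (Fin m) (Fin n) DualQuaternion) :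
    Matrix (Fin (m + 1)) (Fin (n + 1)) DualQuaternion :=
  Matrix.of (Fin.cons (Fin.cons a 0) fun i => Fin.cons 0 (M i))

section border

variable {l m n : ℕ} (a b : DualQuaternion) (M : Matrix (Fin m) (Fin n) DualQuaternion)

@[simp] theorem border_zero_zero : border a M 0 0 = a := rfl

@[simp] theorem border_zero_succ (j : Fin n) : border a M 0 j.succ = 0 := rfl

@[simp] theorem border_succ_zero (i : Fin m) : border a M i.succ 0 = 0 := rfl

@[simp] theorem border_succ_succ (i : Fin m) (j : Fin n) : border a M i.succ j.succ = M i j := rfl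

theorem border_mul_border (L : Matrix (Fin l) (Fin m) DualQuaternion) :
    border a L * border b M = border (a * b) (L * M) := by
  ext1 i j
  cases i using Fin.cases <;> cases j using Fin.cases <;>
    simp [Matrix.mul_apply, Fin.sum_univ_succ]

theorem conjTranspose_border : (border a M)ᴴ = border (star a) Mᴴ := by
  ext1 i j
  cases i using Fin.cases <;> cases j using Fin.cases <;> simp

theorem border_one_one : border 1 (1 : Matrix (Fin n) (Fin n) DualQuaternion) = 1 := by
  ext1 i j
  cases i using Fin.cases <;> cases j using Fin.cases <;> simp [Matrix.one_apply, Fin.succ_ne_zero]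
  exact (Fin.succ_ne_zero _).symm

end border

theorem IsUnitaryMatrix.mul {n : ℕ} {U W : Matrix (Fin n) (Fin n) DualQuaternion}
    (hU : IsUnitaryMatrix U) (hW : IsUnitaryMatrix W) : IsUnitaryMatrix (U * W) := by
  rw [IsUnitaryMatrix, Matrix.conjTranspose_mul, mul_assoc, ← mul_assoc _ U, hU, one_mul, hW]

theorem IsUnitaryMatrix.border {n : ℕ} {U : Matrix (Fin n) (Fin n) DualQuaternion}
    (hU : IsUnitaryMatrix U) : IsUnitaryMatrix (border 1 U) := by
  rw [IsUnitaryMatrix, conjTranspose_border, border_mul_border, hU, star_one, one_mul,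
    border_one_one]

theorem isUnitaryMatrix_one {n : ℕ} :
    IsUnitaryMatrix (1 : Matrix (Fin n) (Fin n) DualQuaternion) := by
  rw [IsUnitaryMatrix, Matrix.conjTranspose_one, one_mul]

theorem col_mul {l m n : ℕ} (A : Matrix (Fin l) (Fin m) DualQuaternion)
    (B : Matrix (Fin m) (Fin n) DualQuaternion) (j : Fin n) : (A * B).col j = A *ᵥ B.col j := rfl

/-- Unitary matrices split off a singular value. -/
theorem exists_unitary_eq_border {m n : ℕ}
    (B : Matrix (Fin (m + 1)) (Fin (n + 1)) DualQuaternion) :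
    ∃ (d : DualNumber ℝ) (V : Matrix (Fin (m + 1)) (Fin (m + 1)) DualQuaternion)
      (U : Matrix (Fin (n + 1)) (Fin (n + 1)) DualQuaternion)
      (C : Matrix (Fin m) (Fin n) DualQuaternion), DualLE 0 d ∧ IsUnitaryMatrix V ∧
      IsUnitaryMatrix U ∧ Vᴴ * B * U = border (ofDual d) C := by
  obtain ⟨u, v, d, hd, hu, hv, hBu, hBv⟩ := exists_singularTriple B
  obtain ⟨U, hU, hUu⟩ := exists_unitary_col_zero hu
  obtain ⟨V, hV, hVv⟩ := exists_unitary_col_zero hv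
  -- The first column is `V^* B u = V^* v d = e₀ d`. The relation `B^* v = u d` gives the first row
  -- in the same way, after conjugate transposition.
  have hcol (i : Fin (m + 1)) :
      (Vᴴ * B * U) i 0 = (1 : Matrix (Fin (m + 1)) (Fin (m + 1)) _) i 0 * ofDual d := by
    have h1 : (Vᴴ * B * U).col 0 = MulOpposite.op (ofDual d) • (Vᴴ * V).col 0 := by
      rw [Matrix.mul_assoc, col_mul, col_mul, hUu, hBu, Matrix.mulVec_smul, ← hVv,
        ← col_mul]
    rw [hV] at h1
    exact congrFun h1 i
  have hrow (j : Fin (n + 1)) :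
      (Uᴴ * Bᴴ * V) j 0 = (1 : Matrix (Fin (n + 1)) (Fin (n + 1)) _) j 0 * ofDual d := by
    have h1 : (Uᴴ * Bᴴ * V).col 0 = MulOpposite.op (ofDual d) • (Uᴴ * U).col 0 := by
      rw [Matrix.mul_assoc, col_mul, col_mul, hVv, hBv, Matrix.mulVec_smul, ← hUu,
        ← col_mul]
    rw [hU] at h1
    exact congrFun h1 j
  have hconj : (Vᴴ * B * U)ᴴ = Uᴴ * Bᴴ * V := by
    simp [Matrix.conjTranspose_mul, Matrix.mul_assoc]
  refine ⟨d, V, U, Matrix.of fun i j => (Vᴴ * B * U) i.succ j.succ, hd, hV, hU, ?_⟩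
  ext1 i j
  cases i using Fin.cases with
  | zero =>
    cases j using Fin.cases with
    | zero => simp [hcol]
    | succ j =>
      rw [← star_star ((Vᴴ * B * U) 0 j.succ), ← Matrix.conjTranspose_apply, hconj, hrow]
      simp [Fin.succ_ne_zero]
  | succ i =>
    cases j using Fin.cases with
    | zero => simp [hcol, Fin.succ_ne_zero]
    | succ j => simp

/-- Indexing `μ` by `ℕ` lets the induction prepend `d` without handling `min m n`; the values from
`min m n` on play no role. -/
theorem exists_unitary_diagonalization {m n : ℕ} (B : Matrix (Fin m) (Fin n) DualQuaternion) :
    ∃ (μ : ℕ → DualNumber ℝ) (V : Matrix (Fin m) (Fin m) DualQuaternion)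
      (U : Matrix (Fin n) (Fin n) DualQuaternion), (∀ i, DualLE 0 (μ i)) ∧ IsUnitaryMatrix V ∧
      IsUnitaryMatrix U ∧
      Vᴴ * B * U = Matrix.of fun (i : Fin m) (j : Fin n) =>
        if (i : ℕ) = (j : ℕ) then ofDual (μ i) else 0 := by
  have hrefl : DualLE 0 0 := Or.inr ⟨rfl, le_rfl⟩
  induction m generalizing n with
  | zero =>
    exact ⟨0, 1, 1, fun _ => hrefl, isUnitaryMatrix_one, isUnitaryMatrix_one,
      Matrix.ext fun i => i.elim0⟩
  | succ m ih =>
    cases n with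
    | zero =>
      exact ⟨0, 1, 1, fun _ => hrefl, isUnitaryMatrix_one, isUnitaryMatrix_one,
        Matrix.ext fun _ j => j.elim0⟩
    | succ n =>
      obtain ⟨d, V, U, C, hd, hV, hU, hB⟩ := exists_unitary_eq_border B
      obtain ⟨μ, V', U', hμ, hV', hU', hC⟩ := ih C
      refine ⟨fun i => Nat.casesOn i d μ, V * border 1 V', U * border 1 U', ?_,
        hV.mul hV'.border, hU.mul hU'.border, ?_⟩
      · rintro (_ | i)
        exacts [hd, hμ i]
      · have h1 : (V * border 1 V')ᴴ * B * (U * border 1 U') =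
            (border 1 V')ᴴ * (Vᴴ * B * U) * border 1 U' := by
          simp only [Matrix.conjTranspose_mul, Matrix.mul_assoc]
        rw [h1, hB, conjTranspose_border, border_mul_border, border_mul_border, hC, star_one,
          one_mul, mul_one]
        ext1 i j
        cases i using Fin.cases <;> cases j using Fin.cases <;> simp

/-! ### Sorting the singular values -/

theorem exists_perm_dualLE {k : ℕ} (f : Fin k → DualNumber ℝ) :
    ∃ σ : Equiv.Perm (Fin k), ∀ i j, i ≤ j → DualLE (f (σ j)) (f (σ i)) := by
  -- `DualLE` is the lexicographic order; its dual is used because `Tuple.sort` sorts increasingly.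
  let g : Fin k → (ℝ ×ₗ ℝ)ᵒᵈ := fun i => OrderDual.toDual (toLex ((f i).fst, (f i).snd))
  refine ⟨Tuple.sort g, fun i j hij => ?_⟩
  have h1 := OrderDual.toDual_le_toDual.mp (Tuple.monotone_sort g hij)
  exact Prod.Lex.toLex_le_toLex.mp h1

theorem IsUnitaryMatrix.submatrix {n : ℕ} {U : Matrix (Fin n) (Fin n) DualQuaternion}
    (hU : IsUnitaryMatrix U) (σ : Equiv.Perm (Fin n)) : IsUnitaryMatrix (U.submatrix id σ) := by
  rw [IsUnitaryMatrix, Matrix.conjTranspose_submatrix,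
    ← Matrix.submatrix_mul _ _ _ _ _ Function.bijective_id, hU, Matrix.submatrix_one_equiv]

theorem exists_isSingularValues {m n : ℕ} (B : Matrix (Fin m) (Fin n) DualQuaternion) :
    ∃ μ : Fin (min m n) → DualNumber ℝ, IsSingularValues B μ := by
  obtain ⟨μ, V, U, hμ, hV, hU, hB⟩ := exists_unitary_diagonalization B
  obtain ⟨σ, hσ⟩ := exists_perm_dualLE fun i : Fin (min m n) => μ i
  set e := Fin.castLEEmb (min_le_left m n)
  set e' := Fin.castLEEmb (min_le_right m n)
  -- The same `σ` permutes the columns of `V` and of `U`, extended by the identity to the indices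
  -- from `min m n` on.
  refine ⟨fun i => μ (σ i), fun i => hμ _, hσ, V.submatrix id (σ.viaFintypeEmbedding e),
    U.submatrix id (σ.viaFintypeEmbedding e'), hV.submatrix _, hU.submatrix _, ?_⟩
  have h1 : (V.submatrix id (σ.viaFintypeEmbedding e))ᴴ * B *
      U.submatrix id (σ.viaFintypeEmbedding e') =
      (Vᴴ * B * U).submatrix (σ.viaFintypeEmbedding e) (σ.viaFintypeEmbedding e') := by
    rw [Matrix.submatrix_mul _ _ _ _ _ Function.bijective_id,
      Matrix.submatrix_mul _ _ _ _ _ Function.bijective_id, Matrix.conjTranspose_submatrix,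
      Matrix.submatrix_id_id]
  have hlt {k : ℕ} (h : min m n ≤ k) (i : Fin k) :
      (∃ i' : Fin (min m n), i = Fin.castLEEmb h i' ∧
        σ.viaFintypeEmbedding (Fin.castLEEmb h) i = Fin.castLEEmb h (σ i')) ∨
      (min m n ≤ (i : ℕ) ∧ σ.viaFintypeEmbedding (Fin.castLEEmb h) i = i) := by
    by_cases hi : (i : ℕ) < min m n
    · exact Or.inl ⟨⟨i, hi⟩, rfl, Equiv.Perm.viaFintypeEmbedding_apply_image σ _ ⟨i, hi⟩⟩
    · refine Or.inr ⟨not_lt.mp hi, Equiv.Perm.viaFintypeEmbedding_apply_notMem_range _ _ ?_⟩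
      rintro ⟨x, rfl⟩
      exact hi x.2
  rw [h1, hB]
  ext1 i j
  simp only [Matrix.submatrix_apply, Matrix.of_apply, rectDiagonal]
  have hij : ¬ (min m n ≤ (i : ℕ) ∧ min m n ≤ (j : ℕ)) := by omega
  rcases hlt (min_le_left m n) i with ⟨i', rfl, hi⟩ | ⟨hi', hi⟩ <;>
    rcases hlt (min_le_right m n) j with ⟨j', rfl, hj⟩ | ⟨hj', hj⟩
  · rw [hi, hj]
    by_cases h : i' = j'
    · subst h
      simp
    · have h2 : ((σ i' : Fin _) : ℕ) ≠ (σ j' : ℕ) := fun h3 => h (σ.injective (Fin.ext h3))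
      have h3 : (i' : ℕ) ≠ (j' : ℕ) := fun h3 => h (Fin.ext h3)
      simp [h2, h3]
  · rw [hi, hj, if_neg, dif_neg]
    · have := i'.2
      simp only [Fin.castLEEmb_apply, Fin.val_castLE]
      omega
    · have := (σ i').2
      simp only [Fin.castLEEmb_apply, Fin.val_castLE]
      omega
  · rw [hi, hj, if_neg, dif_neg]
    · have := j'.2
      simp only [Fin.castLEEmb_apply, Fin.val_castLE]
      omega
    · have := (σ j').2
      simp only [Fin.castLEEmb_apply, Fin.val_castLE]
      omega
  · exact absurd ⟨hi', hj'⟩ hij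

/-! ### Right column rank of quaternion matrices -/

/-- Left multiplication by a quaternion matrix as a right linear map. -/
def mulVecRightLinear {l m : ℕ} (W : Matrix (Fin l) (Fin m) ℍ[ℝ]) :
    (Fin m → ℍ[ℝ]) →ₗ[(ℍ[ℝ])ᵐᵒᵖ] (Fin l → ℍ[ℝ]) where
  toFun := W.mulVec
  map_add' := Matrix.mulVec_add W
  map_smul' c x := Matrix.mulVec_smul W c x

theorem finite_span_range_col {m n : ℕ} (A : Matrix (Fin m) (Fin n) ℍ[ℝ]) :
    Module.Finite (ℍ[ℝ])ᵐᵒᵖ (Submodule.span (ℍ[ℝ])ᵐᵒᵖ (Set.range A.col)) :=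
  Module.Finite.span_of_finite _ (Set.finite_range _)

theorem quaternionRank_mul_le_right {l m n : ℕ} (W : Matrix (Fin l) (Fin m) ℍ[ℝ])
    (A : Matrix (Fin m) (Fin n) ℍ[ℝ]) : quaternionRank (W * A) ≤ quaternionRank A := by
  have h1 : Set.range (W * A).col = mulVecRightLinear W '' Set.range A.col := by
    rw [← Set.range_comp]
    congr 1
  rw [quaternionRank, h1, Submodule.span_image]
  have := finite_span_range_col A
  exact Submodule.finrank_map_le _ _

theorem quaternionRank_mul_le_left {l m n : ℕ} (A : Matrix (Fin l) (Fin m) ℍ[ℝ])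
    (W : Matrix (Fin m) (Fin n) ℍ[ℝ]) : quaternionRank (A * W) ≤ quaternionRank A := by
  have := finite_span_range_col A
  refine Submodule.finrank_mono (Submodule.span_le.mpr ?_)
  rintro _ ⟨j, rfl⟩
  have h1 : (A * W).col j = ∑ k, MulOpposite.op (W k j) • A.col k := by
    ext1 i
    simp [Matrix.mul_apply]
  rw [h1]
  exact Submodule.sum_mem _ fun k _ => Submodule.smul_mem _ _ (Submodule.subset_span ⟨k, rfl⟩)

theorem quaternionRank_eq_of_mul_eq {m n : ℕ} {A D : Matrix (Fin m) (Fin n) ℍ[ℝ]}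
    {V : Matrix (Fin m) (Fin m) ℍ[ℝ]} {U : Matrix (Fin n) (Fin n) ℍ[ℝ]} (hV : Vᴴ * V = 1)
    (hU : Uᴴ * U = 1) (h : Vᴴ * A * U = D) : quaternionRank D = quaternionRank A := by
  have hV' : V * Vᴴ = 1 := (Matrix.mul_eq_one_comm_of_card_eq _ _ _ rfl).mp hV
  have hU' : U * Uᴴ = 1 := (Matrix.mul_eq_one_comm_of_card_eq _ _ _ rfl).mp hU
  have hA : A = V * D * Uᴴ := by
    calc A = (V * Vᴴ) * A * (U * Uᴴ) := by rw [hV', hU', Matrix.one_mul, Matrix.mul_one]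
      _ = V * D * Uᴴ := by rw [← h]; simp only [Matrix.mul_assoc]
  apply le_antisymm
  · rw [← h]
    exact (quaternionRank_mul_le_left _ _).trans (quaternionRank_mul_le_right _ _)
  · rw [hA]
    exact (quaternionRank_mul_le_left _ _).trans (quaternionRank_mul_le_right _ _)

/-- Column `i` is `e_i` scaled by `(μ i).fst`, and columns from `min m n` on vanish. A nonzero
scalar is invertible, so the column span has the basis of those `e_i` with `μ i` appreciable. -/
theorem quaternionRank_stdPart_rectDiagonal {m n : ℕ} (μ : Fin (min m n) → DualNumber ℝ) :
    quaternionRank (stdPart (rectDiagonal μ : Matrix (Fin m) (Fin n) DualQuaternion)) =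
      {i | Appreciable (μ i)}.ncard := by
  classical
  let e : {i // Appreciable (μ i)} → Fin m → ℍ[ℝ] :=
    fun i => Pi.single (Fin.castLE (min_le_left m n) i) 1
  have hcol (i : Fin (min m n)) :
      (stdPart (rectDiagonal μ : Matrix (Fin m) (Fin n) DualQuaternion)).col
        (Fin.castLE (min_le_right m n) i) =
      MulOpposite.op ((μ i).fst : ℍ[ℝ]) • Pi.single (Fin.castLE (min_le_left m n) i) 1 := by
    ext1 k
    by_cases hk : (k : ℕ) = i
    · have : k = Fin.castLE (min_le_left m n) i := Fin.ext hk
      subst this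
      simp [stdPart, rectDiagonal]
    · have : k ≠ Fin.castLE (min_le_left m n) i := fun h => hk (congrArg Fin.val h)
      simp [stdPart, rectDiagonal, hk, this]
  have hspan : Submodule.span (ℍ[ℝ])ᵐᵒᵖ (Set.range
      (stdPart (rectDiagonal μ : Matrix (Fin m) (Fin n) DualQuaternion)).col) =
      Submodule.span (ℍ[ℝ])ᵐᵒᵖ (Set.range e) := by
    apply le_antisymm <;> rw [Submodule.span_le]
    · rintro _ ⟨j, rfl⟩
      by_cases hj : (j : ℕ) < min m n
      · have h1 := hcol ⟨j, hj⟩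
        by_cases h0 : Appreciable (μ ⟨j, hj⟩)
        · change Matrix.col _ (Fin.castLE (min_le_right m n) ⟨j, hj⟩) ∈ _
          rw [h1]
          exact Submodule.smul_mem _ _ (Submodule.subset_span ⟨⟨_, h0⟩, rfl⟩)
        · change Matrix.col _ (Fin.castLE (min_le_right m n) ⟨j, hj⟩) ∈ _
          rw [Appreciable, not_not] at h0
          rw [h1, h0, Quaternion.coe_zero, MulOpposite.op_zero, zero_smul]
          exact Submodule.zero_mem _
      · have h1 : (stdPart (rectDiagonal μ : Matrix (Fin m) (Fin n) DualQuaternion)).col j = 0 := by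
          ext1 k
          have hk : (k : ℕ) ≠ j := by omega
          simp [stdPart, rectDiagonal, hk]
        rw [h1]
        exact Submodule.zero_mem _
    · rintro _ ⟨⟨i, hi⟩, rfl⟩
      have h0 : MulOpposite.op ((μ i).fst : ℍ[ℝ]) ≠ 0 := by
        rw [MulOpposite.op_ne_zero_iff]
        exact fun h => hi (Quaternion.coe_injective h)
      change Pi.single (Fin.castLE (min_le_left m n) i) 1 ∈ Submodule.span (ℍ[ℝ])ᵐᵒᵖ _
      rw [← Submodule.smul_mem_iff _ h0, ← hcol i]
      exact Submodule.subset_span ⟨_, rfl⟩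
  have hli : LinearIndependent (ℍ[ℝ])ᵐᵒᵖ e := by
    rw [Fintype.linearIndependent_iff]
    intro g hg i
    have h1 := congrFun hg (Fin.castLE (min_le_left m n) i)
    rw [Finset.sum_apply, Finset.sum_eq_single i] at h1
    · simpa [e] using h1
    · intro j _ hj
      have : Fin.castLE (min_le_left m n) (i : Fin (min m n)) ≠
          Fin.castLE (min_le_left m n) (j : Fin (min m n)) := fun h =>
        hj (Subtype.ext (Fin.castLE_injective _ h.symm))
      simp [e, this]
    · simp
  rw [quaternionRank, hspan, finrank_span_eq_card hli, ← Nat.card_eq_fintype_card]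
  rfl

/-- As `μ` comes from an arbitrary decomposition, this also gives independence of the decomposition.
-/
theorem ncard_appreciable_eq_quaternionRank {m n : ℕ} {B : Matrix (Fin m) (Fin n) DualQuaternion}
    {μ : Fin (min m n) → DualNumber ℝ} (h : IsSingularValues B μ) :
    {i | Appreciable (μ i)}.ncard = quaternionRank (stdPart B) := by
  obtain ⟨-, -, V, U, hV, hU, hB⟩ := h
  rw [← quaternionRank_stdPart_rectDiagonal (m := m) (n := n)]
  refine quaternionRank_eq_of_mul_eq (V := stdPart V) (U := stdPart U) ?_ ?_ ?_
  · rw [← stdPart_conjTranspose, ← stdPart_mul, hV, stdPart_one]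
  · rw [← stdPart_conjTranspose, ← stdPart_mul, hU, stdPart_one]
  · rw [← stdPart_conjTranspose, ← stdPart_mul, ← stdPart_mul, hB]

end DualQuaternion

theorem proposition6p2 {m n : ℕ} (B : Matrix (Fin m) (Fin n) DualQuaternion) :
    (∃ μ : Fin (min m n) → DualNumber ℝ, DualQuaternion.IsSingularValues B μ) ∧
    ∀ r : ℕ, DualQuaternion.IsAppreciableRank B r ↔
      r = DualQuaternion.quaternionRank (DualQuaternion.stdPart B) := by
  obtain ⟨μ, hμ⟩ := DualQuaternion.exists_isSingularValues B
  refine ⟨⟨μ, hμ⟩, fun r => ⟨?_, ?_⟩⟩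
  · rintro ⟨ν, hν, rfl⟩
    exact DualQuaternion.ncard_appreciable_eq_quaternionRank hν
  · rintro rfl
    exact ⟨μ, hμ, DualQuaternion.ncard_appreciable_eq_quaternionRank hμ⟩
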